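/- Let $\mathcal H$ be a complex Hilbert space and let $A,B$ be bounded linear operators on $\mathcal H$ with $AB=BA$, $AB^*=B^*A$ and $|A|B=B^*|A|$, where $|T|=(T^*T)^{1/2}$. Let $f,g:[0,\infty)\to[0,\infty)$ be continuous with $f(t)g(t)=t$ for all $t\ge 0$, and let $n,m>1$ and $p\ge 1$ be real numbers with $\frac1n+\frac1m=1$, $pn\ge 2$ and $pm\ge 2$. Let $\|\cdot\|$ be the operator norm, $r(T)$ the spectral radius of $T$, $w(T)=\sup_{\|x\|=1}|\langle Tx,x\rangle|$ its numerical radius and, for $\alpha,\beta\ge 0$, let $$\|T\|_{\alpha,\beta}=\sup_{\|x\|=1}\sqrt{\alpha|\langle Tx,x\rangle|^2+\beta\|Tx\|^2}.$$ Put $$X=\tfrac1n f^{np}(|A|)+\tfrac1m g^{mp}(|A^*|),\qquad Y=\tfrac1n f^{np}(|A^*A|)+\tfrac1m g^{mp}(|A^*A|),$$ where $f^{np}$ is the function $t\mapsto f(t)^{np}$, $g^{mp}$ is the function $t\mapsto g(t)^{mp}$, and they are applied to positive operators by the continuous functional calculus. Then: (i) for all $\alpha,\beta\ge 0$ with $\alpha+\beta=1$,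 $$\|AB\|_{\alpha,\beta}\le\left\|\alpha\, r(B)^{2p}X^2+\beta\, r(B^*B)^{p}\,Y\right\|^{\frac1{2p}};$$ (ii) $$w(AB)\le\inf_{\alpha,\beta\ge 0,\ \alpha+\beta=1}\left\|\alpha\, r(B)^{2p}X^2+\beta\, r(B^*B)^{p}\,Y\right\|^{\frac1{2p}}.$$ (On the space $\mathcal H=\{0\}$ all suprema are read as $0$.) -/

import Mathlib

namespace AlphaBetaNorm

noncomputable section

variable {H : Type*} [NormedAddCommGroup H] [InnerProductSpace ℂ H]

/-- The `(α, β)`-norm of a bounded operator `T`, for `α, β ≥ 0`: the supremum of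
`√(α |⟨T x, x⟩|² + β ‖T x‖²)` over the unit vectors `x`. -/
def abNorm (α β : ℝ) (T : H →L[ℂ] H) : ℝ :=
  sSup {s : ℝ | ∃ x : H, ‖x‖ = 1 ∧
    s = Real.sqrt (α * ‖(inner ℂ (T x) x : ℂ)‖ ^ 2 + β * ‖T x‖ ^ 2)}

/-- The numerical radius of `T`: the supremum of `|⟨T x, x⟩|` over the unit vectors `x`. -/
def numRadius (T : H →L[ℂ] H) : ℝ :=
  sSup {s : ℝ | ∃ x : H, ‖x‖ = 1 ∧ s = ‖(inner ℂ (T x) x : ℂ)‖}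

/-- The spectral radius of `T` as a real number (Mathlib's takes values in `[0, ∞]`, and it is
finite for bounded operators). -/
def specRadius (T : H →L[ℂ] H) : ℝ :=
  (spectralRadius ℂ T).toReal

theorem specRadius_finite [CompleteSpace H] (T : H →L[ℂ] H) : spectralRadius ℂ T ≠ ⊤ := by
  rcases subsingleton_or_nontrivial H with h | h
  · simp [spectralRadius]
  · exact ((spectrum.spectralRadius_le_nnnorm T).trans_lt ENNReal.coe_lt_top).ne

/-- The suprema in the definitions above are suprema of bounded sets. -/
theorem norm_inner_le (T : H →L[ℂ] H) {x : H} (hx : ‖x‖ = 1) :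
    ‖(inner ℂ (T x) x : ℂ)‖ ≤ ‖T‖ := by
  have h1 := norm_inner_le_norm (𝕜 := ℂ) (T x) x
  have h2 := T.le_opNorm x
  rw [hx, mul_one] at h1 h2
  exact h1.trans h2

theorem numRadius_bddAbove (T : H →L[ℂ] H) :
    BddAbove {s : ℝ | ∃ x : H, ‖x‖ = 1 ∧ s = ‖(inner ℂ (T x) x : ℂ)‖} := by
  refine ⟨‖T‖, ?_⟩
  rintro s ⟨x, hx, rfl⟩
  exact norm_inner_le T hx

theorem abNorm_bddAbove {α β : ℝ} (hα : 0 ≤ α) (hβ : 0 ≤ β) (T : H →L[ℂ] H) :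
    BddAbove {s : ℝ | ∃ x : H, ‖x‖ = 1 ∧
      s = Real.sqrt (α * ‖(inner ℂ (T x) x : ℂ)‖ ^ 2 + β * ‖T x‖ ^ 2)} := by
  refine ⟨Real.sqrt (α * ‖T‖ ^ 2 + β * ‖T‖ ^ 2), ?_⟩
  rintro s ⟨x, hx, rfl⟩
  have h1 := norm_inner_le T hx
  have h2 := T.le_opNorm x
  rw [hx, mul_one] at h2
  gcongr

/-- For positive operators `S`, `T` this is `(1/n) f^{np}(S) + (1/m) g^{mp}(T)`, where `f^{np}`
denotes the function `t ↦ f(t)^{np}` and functions are applied to operators by the (unital)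
continuous functional calculus. -/
def youngSum [CompleteSpace H] (f g : ℝ → ℝ) (n m p : ℝ) (S T : H →L[ℂ] H) : H →L[ℂ] H :=
  (1 / n) • cfc (fun t : ℝ => f t ^ (n * p)) S + (1 / m) • cfc (fun t : ℝ => g t ^ (m * p)) T

end

end AlphaBetaNorm

/-!
Everything rests on the pointwise bound, `norm_inner_mul_rpow_le`,
`|⟨A B x, x⟩| ^ p ≤ r(B) ^ p ⟨X x, x⟩` for unit vectors `x`.
The theorem follows from it in three steps. Squaring gives
`|⟨A B x, x⟩| ^ (2p) ≤ r(B) ^ (2p) ⟨X² x, x⟩`. The hypotheses make `A⋆A` and `B⋆B` commute, with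
`‖A B x‖² = ⟨A⋆A B⋆B x, x⟩`, so the same bound for the pair `A⋆A`, `B⋆B` gives
`‖A B x‖ ^ (2p) ≤ r(B⋆B) ^ p ⟨Y x, x⟩`. Convexity of `t ↦ t ^ p` combines the two. The bound on the
numerical radius holds because `w(T) ≤ ‖T‖_{α,β}` whenever `α + β = 1`.

The pointwise bound comes from the inequality
`|⟨A B x, y⟩| ≤ r(B) ‖f(|A|) x‖ ‖g(|A⋆|) y‖` (`norm_inner_mul_le`) together with Young's inequality
and the Hölder–McCarthy inequality (`norm_cfc_apply_rpow_le`).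

For `norm_inner_mul_le`, let `P` be the projection onto `(ker A)ᗮ`. Since `B` commutes with `A` and
`A⋆`, it commutes with `|A|` and `P`, and then `|A| B = B⋆ |A|` forces `P B = P B⋆`. So `P B` is
self-adjoint with `(P B) ^ k = P B ^ k`, and Gelfand's formula bounds its norm by `r(B)`. As
`A B = A (P B)` and `P B` commutes with `f(|A|)`, the case `B = 1`, which is the mixed Schwarz
inequality `norm_inner_le_norm_cfc_abs`, is enough. That case uses no polar decomposition, only
the intertwining `A φ(|A|) = φ(|A⋆|) A` (`semiconjBy_abs`, `semiconjBy_cfc`).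
-/

open Filter Topology

namespace AlphaBetaNorm

/-! ### Intertwining and the continuous functional calculus -/

section CStarAlgebra

theorem semiconjBy_aeval {𝒜 : Type*} [Ring 𝒜] [Algebra ℝ 𝒜] {c x y : 𝒜}
    (h : SemiconjBy c x y) (q : Polynomial ℝ) :
    SemiconjBy c (Polynomial.aeval x q) (Polynomial.aeval y q) := by
  induction q using Polynomial.induction_on' with
  | add p q hp hq => simpa using hp.add_right hq
  | monomial n a =>
    rw [Polynomial.aeval_monomial, Polynomial.aeval_monomial]
    have h1 : SemiconjBy c (algebraMap ℝ 𝒜 a) (algebraMap ℝ 𝒜 a) := (Algebra.commutes a c).symm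
    exact h1.mul_right (h.pow_right n)

variable {𝒜 : Type*} [CStarAlgebra 𝒜] [PartialOrder 𝒜] [StarOrderedRing 𝒜]

theorem spectrum_subset_Icc {x : 𝒜} (hx : 0 ≤ x) : spectrum ℝ x ⊆ Set.Icc 0 ‖x‖ := by
  nontriviality 𝒜
  intro t ht
  exact ⟨spectrum_nonneg_of_nonneg hx ht,
    (le_abs_self t).trans (spectrum.norm_le_norm_of_mem ht)⟩

theorem continuousOn_spectrum {x : 𝒜} (hx : 0 ≤ x) {φ : ℝ → ℝ} (hφ : ContinuousOn φ (Set.Ici 0)) :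
    ContinuousOn φ (spectrum ℝ x) :=
  hφ.mono fun _ ht => spectrum_nonneg_of_nonneg hx ht

/-- If `c x = y c` for positive `x` and `y`, then `c φ(x) = φ(y) c`: this is clear for polynomials,
and `φ` is a uniform limit of polynomials on an interval containing both spectra. -/
theorem semiconjBy_cfc {c x y : 𝒜} (hx : 0 ≤ x) (hy : 0 ≤ y) (h : SemiconjBy c x y) {φ : ℝ → ℝ}
    (hφ : ContinuousOn φ (Set.Ici 0)) : SemiconjBy c (cfc φ x) (cfc φ y) := by
  rw [SemiconjBy, ← sub_eq_zero, ← norm_eq_zero]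
  refine le_antisymm (le_of_forall_pos_le_add fun ε hε => ?_) (norm_nonneg _)
  set δ : ℝ := ε / (2 * (‖c‖ + 1)) with hδ
  have hδ0 : 0 < δ := by positivity
  obtain ⟨q, hq⟩ := exists_polynomial_near_of_continuousOn 0 (max ‖x‖ ‖y‖) φ
    (hφ.mono Set.Icc_subset_Ici_self) δ hδ0
  have key : ∀ z : 𝒜, 0 ≤ z → ‖z‖ ≤ max ‖x‖ ‖y‖ →
      ‖cfc φ z - Polynomial.aeval z q‖ ≤ δ := by
    intro z hz hzle
    rw [← cfc_polynomial q z hz.isSelfAdjoint,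
      ← cfc_sub φ q.eval z (continuousOn_spectrum hz hφ) q.continuous.continuousOn]
    refine norm_cfc_le hδ0.le fun t ht => ?_
    have h2 := spectrum_subset_Icc hz ht
    rw [Real.norm_eq_abs, abs_sub_comm]
    exact (hq t ⟨h2.1, h2.2.trans hzle⟩).le
  have e : c * cfc φ x - cfc φ y * c =
      c * (cfc φ x - Polynomial.aeval x q) - (cfc φ y - Polynomial.aeval y q) * c := by
    rw [mul_sub, sub_mul, (semiconjBy_aeval h q).eq]
    abel
  have h1 := key x hx (le_max_left _ _)
  have h2 := key y hy (le_max_right _ _)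
  calc ‖c * cfc φ x - cfc φ y * c‖
      ≤ ‖c‖ * ‖cfc φ x - Polynomial.aeval x q‖ + ‖cfc φ y - Polynomial.aeval y q‖ * ‖c‖ := by
        rw [e]
        exact (norm_sub_le _ _).trans (add_le_add (norm_mul_le _ _) (norm_mul_le _ _))
    _ ≤ ‖c‖ * δ + δ * ‖c‖ := by gcongr
    _ ≤ δ * (2 * (‖c‖ + 1)) := by nlinarith
    _ = 0 + ε := by rw [hδ]; field_simp; simp

theorem semiconjBy_abs (a : 𝒜) : SemiconjBy a (CFC.abs a) (CFC.abs (star a)) := by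
  have h : SemiconjBy a (star a * a) (a * star a) := by
    rw [SemiconjBy, mul_assoc]
  have h1 : ∀ x : 𝒜, 0 ≤ x → CFC.sqrt x = cfc Real.sqrt x := fun x hx => by
    rw [CFC.sqrt_eq_real_sqrt x hx, cfcₙ_eq_cfc]
  rw [CFC.abs, CFC.abs, star_star, h1 _ (star_mul_self_nonneg a), h1 _ (mul_star_self_nonneg a)]
  exact semiconjBy_cfc (star_mul_self_nonneg a) (mul_star_self_nonneg a) h
    Real.continuous_sqrt.continuousOn

end CStarAlgebra

/-! ### Quadratic forms and radii of operators -/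

section Hilbert

variable {H : Type*} [NormedAddCommGroup H] [InnerProductSpace ℂ H]

theorem reApplyInnerSelf_mono {S T : H →L[ℂ] H} (h : S ≤ T) (x : H) :
    S.reApplyInnerSelf x ≤ T.reApplyInnerSelf x := by
  have h1 := ((ContinuousLinearMap.le_def S T).1 h).re_inner_nonneg_left x
  simp only [ContinuousLinearMap.reApplyInnerSelf_apply]
  simpa [inner_sub_left] using h1

theorem reApplyInnerSelf_le_norm (S : H →L[ℂ] H) {x : H} (hx : ‖x‖ = 1) :
    S.reApplyInnerSelf x ≤ ‖S‖ :=
  (RCLike.re_le_norm _).trans (norm_inner_le S hx)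

theorem reApplyInnerSelf_add (S T : H →L[ℂ] H) (x : H) :
    (S + T).reApplyInnerSelf x = S.reApplyInnerSelf x + T.reApplyInnerSelf x := by
  simp [ContinuousLinearMap.reApplyInnerSelf_apply, inner_add_left]

theorem reApplyInnerSelf_real_smul (c : ℝ) (S : H →L[ℂ] H) (x : H) :
    (c • S).reApplyInnerSelf x = c * S.reApplyInnerSelf x := by
  simp [ContinuousLinearMap.reApplyInnerSelf_apply, inner_smul_left_eq_smul]

theorem specRadius_nonneg (B : H →L[ℂ] H) : 0 ≤ specRadius B := ENNReal.toReal_nonneg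

theorem numRadius_le_abNorm {α β : ℝ} (hα : 0 ≤ α) (hβ : 0 ≤ β) (hαβ : α + β = 1)
    (T : H →L[ℂ] H) : numRadius T ≤ abNorm α β T := by
  refine Real.sSup_le ?_ (Real.sSup_nonneg ?_)
  · rintro s ⟨x, hx, rfl⟩
    refine le_trans ?_ (le_csSup (abNorm_bddAbove hα hβ T) ⟨x, hx, rfl⟩)
    have h1 : ‖(inner ℂ (T x) x : ℂ)‖ ≤ ‖T x‖ := by
      simpa [hx] using norm_inner_le_norm (𝕜 := ℂ) (T x) x
    refine Real.le_sqrt_of_sq_le ?_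
    have h2 := pow_le_pow_left₀ (norm_nonneg _) h1 2
    nlinarith
  · rintro s ⟨x, hx, rfl⟩
    exact Real.sqrt_nonneg _

variable [CompleteSpace H]

theorem norm_apply_sq (S : H →L[ℂ] H) (x : H) :
    ‖S x‖ ^ 2 = (star S * S).reApplyInnerSelf x := by
  rw [ContinuousLinearMap.reApplyInnerSelf_apply, mul_apply_eq_comp,
    ContinuousLinearMap.star_eq_adjoint, ContinuousLinearMap.adjoint_inner_left,
    inner_self_eq_norm_sq]

theorem reApplyInnerSelf_sq_le {S : H →L[ℂ] H} (hS : IsSelfAdjoint S) {x : H} (hx : ‖x‖ = 1) :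
    S.reApplyInnerSelf x ^ 2 ≤ (S ^ 2).reApplyInnerSelf x := by
  have h := (RCLike.abs_re_le_norm _).trans (norm_inner_le_norm (𝕜 := ℂ) (S x) x)
  rw [hx, mul_one] at h
  calc S.reApplyInnerSelf x ^ 2 ≤ ‖S x‖ ^ 2 := sq_le_sq' (neg_le_of_abs_le h) (le_of_abs_le h)
    _ = (S ^ 2).reApplyInnerSelf x := by rw [norm_apply_sq, hS.star_eq, pow_two]

/-! ### The Hölder–McCarthy inequality -/

theorem norm_cfc_apply_sq {S : H →L[ℂ] H} (hS : 0 ≤ S) {φ : ℝ → ℝ}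
    (hφ : ContinuousOn φ (Set.Ici 0)) (x : H) :
    ‖cfc φ S x‖ ^ 2 = (cfc (fun t => φ t ^ 2) S).reApplyInnerSelf x := by
  have hc := continuousOn_spectrum hS hφ
  rw [norm_apply_sq, (IsSelfAdjoint.cfc (f := φ) (a := S)).star_eq, ← cfc_mul φ φ S hc hc]
  simp only [pow_two]

/-- The graph of `t ↦ t ^ r` lies above its tangent at `s`. -/
theorem rpow_tangent_le {s t r : ℝ} (hs : 0 < s) (ht : 0 ≤ t) (hr : 1 ≤ r) :
    s ^ r + r * s ^ (r - 1) * (t - s) ≤ t ^ r := by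
  have h := one_add_mul_self_le_rpow_one_add (s := t / s - 1)
    (by linarith [div_nonneg ht hs.le]) hr
  rw [add_sub_cancel, Real.div_rpow ht hs.le, le_div_iff₀ (Real.rpow_pos_of_pos hs r)] at h
  refine le_trans (le_of_eq ?_) h
  rw [Real.rpow_sub_one hs.ne']
  field_simp

/-- The Hölder–McCarthy inequality `⟨φ(S) x, x⟩ ^ r ≤ ⟨φ(S) ^ r x, x⟩` for a unit vector `x`, by
applying the tangent inequality of `t ↦ t ^ r` at `⟨φ(S) x, x⟩` to the operator `φ(S)`. -/
theorem reApplyInnerSelf_cfc_rpow_le {S : H →L[ℂ] H} (hS : 0 ≤ S) {φ : ℝ → ℝ}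
    (hφ : ContinuousOn φ (Set.Ici 0)) (hφ0 : ∀ t, 0 ≤ t → 0 ≤ φ t) {r : ℝ} (hr : 1 ≤ r)
    {x : H} (hx : ‖x‖ = 1) :
    (cfc φ S).reApplyInnerSelf x ^ r ≤ (cfc (fun t => φ t ^ r) S).reApplyInnerSelf x := by
  have hpos : ∀ t ∈ spectrum ℝ S, 0 ≤ t := fun t ht => spectrum_nonneg_of_nonneg hS ht
  have hc := continuousOn_spectrum hS hφ
  have hcr : ContinuousOn (fun t => φ t ^ r) (spectrum ℝ S) :=
    hc.rpow_const fun t _ => Or.inr (by linarith)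
  have hnn : ∀ ψ : ℝ → ℝ, (∀ t ∈ spectrum ℝ S, 0 ≤ ψ t) → 0 ≤ (cfc ψ S).reApplyInnerSelf x :=
    fun ψ hψ =>
      ((ContinuousLinearMap.nonneg_iff_isPositive _).1 (cfc_nonneg hψ)).re_inner_nonneg_left x
  -- `rpow_tangent_le` needs a positive point of tangency; at `0` the left-hand side vanishes.
  rcases (hnn φ fun t ht => hφ0 t (hpos t ht)).eq_or_lt with h0 | h0
  · rw [← h0, Real.zero_rpow (by linarith)]
    exact hnn _ fun t ht => Real.rpow_nonneg (hφ0 t (hpos t ht)) r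
  · set s := (cfc φ S).reApplyInnerSelf x with hs
    set k := r * s ^ (r - 1) with hk
    have h1 : cfc (fun t => (s ^ r - k * s) + k * φ t) S ≤ cfc (fun t => φ t ^ r) S := by
      refine cfc_mono (fun t ht => ?_) (by fun_prop) hcr
      have := rpow_tangent_le h0 (hφ0 t (hpos t ht)) hr
      rw [← hk] at this
      linarith
    have h2 := reApplyInnerSelf_mono h1 x
    rw [cfc_const_add _ _ S (by fun_prop), cfc_const_mul _ _ S hc, reApplyInnerSelf_add,
      reApplyInnerSelf_real_smul, ← hs, Algebra.algebraMap_eq_smul_one,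
      reApplyInnerSelf_real_smul] at h2
    have h3 : (1 : H →L[ℂ] H).reApplyInnerSelf x = 1 := by
      rw [ContinuousLinearMap.reApplyInnerSelf_apply, one_apply_eq_self,
        inner_self_eq_norm_sq, hx, one_pow]
    rw [h3] at h2
    linarith

/-- The Hölder–McCarthy inequality for `φ ^ 2` and the exponent `s / 2`. -/
theorem norm_cfc_apply_rpow_le {S : H →L[ℂ] H} (hS : 0 ≤ S) {φ : ℝ → ℝ}
    (hφ : ContinuousOn φ (Set.Ici 0)) (hφ0 : ∀ t, 0 ≤ t → 0 ≤ φ t) {s : ℝ} (hs : 2 ≤ s)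
    {x : H} (hx : ‖x‖ = 1) :
    ‖cfc φ S x‖ ^ s ≤ (cfc (fun t => φ t ^ s) S).reApplyInnerSelf x := by
  have h := reApplyInnerSelf_cfc_rpow_le hS (hφ.pow 2) (fun t _ => sq_nonneg (φ t))
    (r := s / 2) (by linarith) hx
  simp only [Pi.pow_apply] at h
  change (cfc (fun t => φ t ^ 2) S).reApplyInnerSelf x ^ (s / 2) ≤ _ at h
  have e : ∀ u : ℝ, 0 ≤ u → (u ^ 2) ^ (s / 2) = u ^ s := fun u hu => by
    rw [← Real.rpow_natCast u 2, ← Real.rpow_mul hu]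
    congr 1
    push_cast
    ring
  rw [← norm_cfc_apply_sq hS hφ, e _ (norm_nonneg _)] at h
  refine h.trans_eq ?_
  congr 1
  exact cfc_congr fun t ht => e _ (hφ0 t (spectrum_nonneg_of_nonneg hS ht))

/-! ### The mixed Schwarz inequality -/

/-- The mixed Schwarz inequality. If `f` is bounded below by a positive constant, then
`⟨A z, y⟩ = ⟨f(|A|) z, f(|A|)⁻¹ A⋆ y⟩`, and `A f(|A|)⁻² A⋆ = g(|A⋆|)²` by intertwining. In general
`f` is replaced by `f + ε`, for which `t / (f t + ε) ≤ g t` still holds, and `ε` tends to `0`. -/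
theorem norm_inner_le_norm_cfc_abs (A : H →L[ℂ] H) {f g : ℝ → ℝ} (hf : ContinuousOn f (Set.Ici 0))
    (hg : ContinuousOn g (Set.Ici 0)) (hf0 : ∀ t, 0 ≤ t → 0 ≤ f t) (hg0 : ∀ t, 0 ≤ t → 0 ≤ g t)
    (hfg : ∀ t, 0 ≤ t → f t * g t = t) (z y : H) :
    ‖(inner ℂ (A z) y : ℂ)‖ ≤ ‖cfc f (CFC.abs A) z‖ * ‖cfc g (CFC.abs (star A)) y‖ := by
  set S := CFC.abs A with hSdef
  set T := CFC.abs (star A) with hTdef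
  have hS : 0 ≤ S := CFC.abs_nonneg A
  have hT : 0 ≤ T := CFC.abs_nonneg (star A)
  have main : ∀ ε : ℝ, 0 < ε → ‖(inner ℂ (A z) y : ℂ)‖ ≤
      (‖cfc f S z‖ + ε * ‖z‖) * ‖cfc g T y‖ := by
    intro ε hε
    have hpos : ∀ t, 0 ≤ t → 0 < ε + f t := fun t ht => by linarith [hf0 t ht]
    have hfε : ContinuousOn (fun t => ε + f t) (Set.Ici 0) := continuousOn_const.add hf
    have hk : ContinuousOn (fun t => (ε + f t)⁻¹) (Set.Ici 0) :=
      hfε.inv₀ fun t ht => (hpos t ht).ne'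
    set K := cfc (fun t => (ε + f t)⁻¹) S with hK
    have hKsa : IsSelfAdjoint K := IsSelfAdjoint.cfc
    have hKF : K * cfc (fun t => ε + f t) S = 1 := by
      rw [hK, ← cfc_mul _ _ S (continuousOn_spectrum hS hk) (continuousOn_spectrum hS hfε)]
      rw [← cfc_one ℝ S hS.isSelfAdjoint]
      refine cfc_congr fun t ht => ?_
      exact inv_mul_cancel₀ (hpos t (spectrum_nonneg_of_nonneg hS ht)).ne'
    have hF : ‖cfc (fun t => ε + f t) S z‖ ≤ ‖cfc f S z‖ + ε * ‖z‖ := by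
      rw [cfc_const_add _ _ S (continuousOn_spectrum hS hf) hS.isSelfAdjoint, add_comm]
      refine (norm_add_le _ _).trans ?_
      rw [Algebra.algebraMap_eq_smul_one]
      simp [norm_smul, abs_of_pos hε]
    have hKA : ‖(K * star A) y‖ ≤ ‖cfc g T y‖ := by
      have h1 : ‖(K * star A) y‖ ^ 2 = (A * (K * K) * star A).reApplyInnerSelf y := by
        rw [norm_apply_sq, star_mul, star_star, hKsa.star_eq]
        congr 1
      have h2 : A * (K * K) * star A = cfc (fun t => ((ε + f t)⁻¹ * t) ^ 2) T := by
        have hsc := semiconjBy_cfc hS hT (semiconjBy_abs A) hk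
        have hkT := continuousOn_spectrum hT hk
        have hid : ContinuousOn (fun t : ℝ => t) (spectrum ℝ T) := continuousOn_id
        rw [(hsc.mul_right hsc).eq, mul_assoc]
        have : A * star A = T * T := by rw [hTdef, CFC.abs_mul_abs, star_star]
        rw [this]
        nth_rewrite 3 4 [← cfc_id' ℝ T hT.isSelfAdjoint]
        rw [← cfc_mul _ _ T hkT hkT, ← cfc_mul _ _ T hid hid,
          ← cfc_mul (fun t => (ε + f t)⁻¹ * (ε + f t)⁻¹) (fun t => t * t) T
            (hkT.mul hkT) (hid.mul hid)]
        exact cfc_congr fun t _ => by ring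
      rw [← abs_of_nonneg (norm_nonneg ((K * star A) y)), ← abs_of_nonneg (norm_nonneg (cfc g T y)),
        ← sq_le_sq, h1, h2, norm_cfc_apply_sq hT hg]
      refine reApplyInnerSelf_mono (cfc_mono (fun t ht => ?_)
        (continuousOn_spectrum hT ((hk.mul continuousOn_id).pow 2))
        (continuousOn_spectrum hT (hg.pow 2))) y
      have ht0 : 0 ≤ t := spectrum_nonneg_of_nonneg hT ht
      have h3 := hpos t ht0
      have h4 : (ε + f t)⁻¹ * t ≤ g t := by
        rw [inv_mul_le_iff₀ h3]
        nlinarith [hfg t ht0, mul_nonneg hε.le (hg0 t ht0)]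
      exact pow_le_pow_left₀ (mul_nonneg (inv_nonneg.2 h3.le) ht0) h4 2
    have e : (inner ℂ (A z) y : ℂ) = inner ℂ (cfc (fun t => ε + f t) S z) ((K * star A) y) := by
      have : A z = A ((K * cfc (fun t => ε + f t) S) z) := by rw [hKF]; rfl
      rw [this, mul_apply_eq_comp, mul_apply_eq_comp,
        ← ContinuousLinearMap.adjoint_inner_right, ← ContinuousLinearMap.adjoint_inner_right,
        ← ContinuousLinearMap.star_eq_adjoint, ← ContinuousLinearMap.star_eq_adjoint, hKsa.star_eq]
    rw [e]
    exact (norm_inner_le_norm _ _).trans (mul_le_mul hF hKA (norm_nonneg _) (by positivity))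
  have hlim : Tendsto (fun ε : ℝ => (‖cfc f S z‖ + ε * ‖z‖) * ‖cfc g T y‖) (𝓝[>] 0)
      (𝓝 (‖cfc f S z‖ * ‖cfc g T y‖)) := by
    have : Continuous fun ε : ℝ => (‖cfc f S z‖ + ε * ‖z‖) * ‖cfc g T y‖ := by fun_prop
    have h := (this.tendsto 0).mono_left (nhdsWithin_le_nhds (s := Set.Ioi 0))
    simpa using h
  exact ge_of_tendsto hlim (eventually_mem_nhdsWithin.mono fun ε hε => main ε hε)

/-! ### Replacing the norm of `B` by its spectral radius -/

theorem norm_le_specRadius_of_norm_pow_le {T B : H →L[ℂ] H} (hT : IsSelfAdjoint T)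
    (h : ∀ k : ℕ, ‖T ^ k‖ ≤ ‖B ^ k‖) : ‖T‖ ≤ specRadius B := by
  have h1 : spectralRadius ℂ T ≤ spectralRadius ℂ B := by
    refine le_of_tendsto_of_tendsto' (spectrum.pow_nnnorm_pow_one_div_tendsto_nhds_spectralRadius T)
      (spectrum.pow_nnnorm_pow_one_div_tendsto_nhds_spectralRadius B) fun k => ?_
    exact ENNReal.rpow_le_rpow (ENNReal.coe_le_coe.2 (h k)) (by positivity)
  rw [T.spectralRadius_eq_nnnorm hT] at h1
  simpa [specRadius] using ENNReal.toReal_mono (specRadius_finite B) h1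

theorem starProjection_mul_eq_zero {A C : H →L[ℂ] H} (h : A * C = 0) :
    (A.kerᗮ).starProjection * C = 0 := by
  ext x
  have h1 : C x ∈ A.ker := by
    rw [LinearMap.mem_ker]
    exact DFunLike.congr_fun h x
  rw [mul_apply_eq_comp, Submodule.starProjection_orthogonal_apply_eq_zero h1]
  rfl

theorem mul_starProjection (A : H →L[ℂ] H) :
    A * (A.kerᗮ).starProjection = A := by
  ext x
  have h1 : x - (A.kerᗮ).starProjection x ∈ A.ker := by
    have := (A.kerᗮ).sub_starProjection_mem_orthogonal x
    rwa [Submodule.orthogonal_orthogonal_eq_closure, A.isClosed_ker.submodule_topologicalClosure_eq]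
      at this
  rw [LinearMap.mem_ker] at h1
  have h2 : A x - A ((A.kerᗮ).starProjection x) = 0 := by simpa using h1
  exact (sub_eq_zero.1 h2).symm

/-- The mixed Schwarz inequality for a product `A B`: the vector `B x` may be replaced by `P B x`,
with `P` the projection onto `(ker A)ᗮ`, and `P B` is self-adjoint of norm at most `r(B)`. -/
theorem norm_inner_mul_le (A B : H →L[ℂ] H) (hAB : A * B = B * A)
    (hAB' : A * star B = star B * A) (habs : CFC.abs A * B = star B * CFC.abs A)
    {f g : ℝ → ℝ} (hf : ContinuousOn f (Set.Ici 0))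
    (hg : ContinuousOn g (Set.Ici 0)) (hf0 : ∀ t, 0 ≤ t → 0 ≤ f t) (hg0 : ∀ t, 0 ≤ t → 0 ≤ g t)
    (hfg : ∀ t, 0 ≤ t → f t * g t = t) (x y : H) :
    ‖(inner ℂ ((A * B) x) y : ℂ)‖ ≤
      specRadius B * (‖cfc f (CFC.abs A) x‖ * ‖cfc g (CFC.abs (star A)) y‖) := by
  set P := (A.kerᗮ).starProjection with hP
  have hPsa : IsSelfAdjoint P := isSelfAdjoint_starProjection _
  have hAP : A * P = A := mul_starProjection A
  have habs0 : ∀ C : H →L[ℂ] H, CFC.abs A * C = 0 → A * C = 0 := by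
    intro C hC
    rw [← CStarRing.star_mul_self_eq_zero_iff, star_mul, mul_assoc, ← mul_assoc (star A),
      ← CFC.abs_mul_abs, mul_assoc, hC, mul_zero, mul_zero]
  have hPcomm : ∀ C : H →L[ℂ] H, A * C = C * A → P * C = P * C * P := by
    intro C hC
    have h1 : A * (C * (1 - P)) = 0 := by
      rw [← mul_assoc, hC, mul_assoc, mul_sub, hAP, mul_one, sub_self, mul_zero]
    have h2 := starProjection_mul_eq_zero h1
    rw [← hP, mul_sub, mul_one, mul_sub, sub_eq_zero] at h2
    rw [mul_assoc]
    exact h2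
  have hPB : Commute P B := by
    -- `P B = P B P` and, by taking adjoints in `P B⋆ = P B⋆ P`, also `B P = P B P`.
    have h1 := congrArg star (hPcomm (star B) hAB')
    simp only [star_mul, star_star, hPsa.star_eq] at h1
    rw [Commute, SemiconjBy, hPcomm B hAB, h1, mul_assoc]
  have hcomm : Commute (CFC.abs A) B := Commute.cfcAbs_left hAB hAB'
  have hcomm' : CFC.abs A * star B = star B * CFC.abs A := by
    have h := (Commute.cfcAbs_left (a := A) (b := star B) hAB' (by rw [star_star]; exact hAB))
    exact h.eq
  have hPB' : P * B = P * star B := by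
    rw [← sub_eq_zero, ← mul_sub]
    refine starProjection_mul_eq_zero (habs0 _ ?_)
    rw [mul_sub, habs, hcomm', sub_self]
  have hsa : IsSelfAdjoint (P * B) := by
    rw [IsSelfAdjoint, hPB.eq, star_mul, hPsa.star_eq, ← hPB', hPB.eq]
  have hPidem : ∀ k : ℕ, ‖P ^ k‖ ≤ 1 := by
    intro k
    induction k with
    | zero => rw [pow_zero]; exact ContinuousLinearMap.norm_id_le
    | succ k ih =>
      rw [pow_succ]
      exact (norm_mul_le _ _).trans
        (mul_le_one₀ ih (norm_nonneg _) (Submodule.starProjection_norm_le _))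
  have hnorm : ‖P * B‖ ≤ specRadius B := by
    refine norm_le_specRadius_of_norm_pow_le hsa fun k => ?_
    rw [hPB.mul_pow]
    exact (norm_mul_le _ _).trans (mul_le_of_le_one_left (norm_nonneg _) (hPidem k))
  have hSP : Commute (CFC.abs A) P := by
    have h1 : CFC.abs A * P = CFC.abs A := by
      have h2 : star (CFC.abs A * (1 - P)) * (CFC.abs A * (1 - P)) = 0 := by
        rw [star_mul, (CFC.abs_nonneg A).isSelfAdjoint.star_eq, mul_assoc, ← mul_assoc (CFC.abs A),
          CFC.abs_mul_abs, mul_assoc, mul_sub A, hAP, mul_one, sub_self, mul_zero, mul_zero]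
      rw [CStarRing.star_mul_self_eq_zero_iff, mul_sub, mul_one, sub_eq_zero] at h2
      exact h2.symm
    have h2 := congrArg star h1
    rw [star_mul, hPsa.star_eq, (CFC.abs_nonneg A).isSelfAdjoint.star_eq] at h2
    exact h1.trans h2.symm
  have hFC : Commute (P * B) (cfc f (CFC.abs A)) :=
    semiconjBy_cfc (CFC.abs_nonneg A) (CFC.abs_nonneg A) (hSP.mul_right hcomm).symm hf
  have e1 : (A * B) x = A ((P * B) x) := by
    rw [← mul_apply_eq_comp, ← mul_assoc, hAP]
  have e2 : ‖cfc f (CFC.abs A) ((P * B) x)‖ ≤ specRadius B * ‖cfc f (CFC.abs A) x‖ := by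
    rw [← mul_apply_eq_comp, ← hFC.eq, mul_apply_eq_comp]
    exact ((P * B).le_opNorm _).trans (by gcongr)
  rw [e1, ← mul_assoc]
  exact (norm_inner_le_norm_cfc_abs A hf hg hf0 hg0 hfg _ y).trans (by gcongr)

/-! ### The pointwise bound -/

theorem isSelfAdjoint_youngSum (f g : ℝ → ℝ) (n m p : ℝ) (S T : H →L[ℂ] H) :
    IsSelfAdjoint (youngSum f g n m p S T) := by
  have h1 : IsSelfAdjoint (cfc (fun t : ℝ => f t ^ (n * p)) S) := IsSelfAdjoint.cfc
  have h2 : IsSelfAdjoint (cfc (fun t : ℝ => g t ^ (m * p)) T) := IsSelfAdjoint.cfc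
  rw [IsSelfAdjoint, youngSum, star_add, star_smul, star_smul, h1.star_eq, h2.star_eq,
    star_trivial, star_trivial]

theorem norm_inner_mul_rpow_le (A B : H →L[ℂ] H) (hAB : A * B = B * A)
    (hAB' : A * star B = star B * A) (habs : CFC.abs A * B = star B * CFC.abs A)
    {f g : ℝ → ℝ} (hf : ContinuousOn f (Set.Ici 0))
    (hg : ContinuousOn g (Set.Ici 0)) (hf0 : ∀ t, 0 ≤ t → 0 ≤ f t) (hg0 : ∀ t, 0 ≤ t → 0 ≤ g t)
    (hfg : ∀ t, 0 ≤ t → f t * g t = t) {n m p : ℝ} (hn : 1 < n) (hnm : 1 / n + 1 / m = 1)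
    (hp : 1 ≤ p) (hpn : 2 ≤ p * n) (hpm : 2 ≤ p * m) {x : H} (hx : ‖x‖ = 1) :
    ‖(inner ℂ ((A * B) x) x : ℂ)‖ ^ p ≤ specRadius B ^ p *
      (youngSum f g n m p (CFC.abs A) (CFC.abs (star A))).reApplyInnerSelf x := by
  have h1 := norm_inner_mul_le A B hAB hAB' habs hf hg hf0 hg0 hfg x x
  set a := ‖cfc f (CFC.abs A) x‖
  set b := ‖cfc g (CFC.abs (star A)) x‖
  have ha : 0 ≤ a := norm_nonneg _
  have hb : 0 ≤ b := norm_nonneg _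
  have hpos := specRadius_nonneg B
  have hconj : n.HolderConjugate m :=
    Real.holderConjugate_iff.2 ⟨hn, by simpa only [one_div] using hnm⟩
  have h2 := Real.rpow_le_rpow (norm_nonneg _) h1 (by linarith : 0 ≤ p)
  rw [Real.mul_rpow hpos (by positivity), Real.mul_rpow ha hb] at h2
  refine h2.trans (mul_le_mul_of_nonneg_left ?_ (by positivity))
  have h3 := Real.young_inequality_of_nonneg (Real.rpow_nonneg ha p) (Real.rpow_nonneg hb p) hconj
  rw [← Real.rpow_mul ha, ← Real.rpow_mul hb] at h3
  have h4 := norm_cfc_apply_rpow_le (CFC.abs_nonneg A) hf hf0 hpn hx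
  have h5 := norm_cfc_apply_rpow_le (CFC.abs_nonneg (star A)) hg hg0 hpm hx
  have hn0 : 0 < n := by linarith
  have hm0 : 0 < m := hconj.symm.pos
  rw [youngSum, reApplyInnerSelf_add, reApplyInnerSelf_real_smul, reApplyInnerSelf_real_smul,
    mul_comm n p, mul_comm m p, one_div_mul_eq_div, one_div_mul_eq_div]
  exact h3.trans (by gcongr)

theorem norm_mul_apply_sq {A B : H →L[ℂ] H} (hAB : A * B = B * A)
    (hAB' : A * star B = star B * A) (x : H) :
    ‖(A * B) x‖ ^ 2 = ‖(inner ℂ (((star A * A) * (star B * B)) x) x : ℂ)‖ := by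
  have hstar : star A * star B = star B * star A := by rw [← star_mul, ← star_mul, hAB]
  have h : (star A * A) * (star B * B) = star (A * B) * (A * B) := by
    calc (star A * A) * (star B * B) = star A * (A * star B) * B := by simp only [mul_assoc]
      _ = star A * star B * (A * B) := by rw [hAB']; simp only [mul_assoc]
      _ = star (A * B) * (A * B) := by rw [hstar, star_mul]
  rw [h, mul_apply_eq_comp (star (A * B)), ContinuousLinearMap.star_eq_adjoint,
    ContinuousLinearMap.adjoint_inner_left, inner_self_eq_norm_sq_to_K]
  simp

end Hilbert

end AlphaBetaNorm

theorem theorem2p12 {H : Type*} [NormedAddCommGroup H] [InnerProductSpace ℂ H] [CompleteSpace H]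
    (A B : H →L[ℂ] H) (hAB : A * B = B * A) (hAB' : A * star B = star B * A)
    (habs : CFC.abs A * B = star B * CFC.abs A)
    (f g : ℝ → ℝ) (hf : ContinuousOn f (Set.Ici 0)) (hg : ContinuousOn g (Set.Ici 0))
    (hf0 : ∀ t, 0 ≤ t → 0 ≤ f t) (hg0 : ∀ t, 0 ≤ t → 0 ≤ g t)
    (hfg : ∀ t, 0 ≤ t → f t * g t = t)
    (n m p : ℝ) (hn : 1 < n) (hm : 1 < m) (hnm : 1 / n + 1 / m = 1) (hp : 1 ≤ p)
    (hpn : 2 ≤ p * n) (hpm : 2 ≤ p * m)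
    (X Y : H →L[ℂ] H)
    (hX : X = AlphaBetaNorm.youngSum f g n m p (CFC.abs A) (CFC.abs (star A)))
    (hY : Y = AlphaBetaNorm.youngSum f g n m p (CFC.abs (star A * A)) (CFC.abs (star A * A))) :
    (∀ α β : ℝ, 0 ≤ α → 0 ≤ β → α + β = 1 →
      AlphaBetaNorm.abNorm α β (A * B) ≤
        ‖(α * AlphaBetaNorm.specRadius B ^ (2 * p)) • X ^ 2 +
          (β * AlphaBetaNorm.specRadius (star B * B) ^ p) • Y‖ ^ (1 / (2 * p))) ∧
    AlphaBetaNorm.numRadius (A * B) ≤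
      sInf {c : ℝ | ∃ α β : ℝ, 0 ≤ α ∧ 0 ≤ β ∧ α + β = 1 ∧
        c = ‖(α * AlphaBetaNorm.specRadius B ^ (2 * p)) • X ^ 2 +
          (β * AlphaBetaNorm.specRadius (star B * B) ^ p) • Y‖ ^ (1 / (2 * p))} := by

  have key : ∀ α β : ℝ, 0 ≤ α → 0 ≤ β → α + β = 1 →
      AlphaBetaNorm.abNorm α β (A * B) ≤
        ‖(α * AlphaBetaNorm.specRadius B ^ (2 * p)) • X ^ 2 +
          (β * AlphaBetaNorm.specRadius (star B * B) ^ p) • Y‖ ^ (1 / (2 * p)) := by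
    intro α β hα hβ hαβ
    set Z := (α * AlphaBetaNorm.specRadius B ^ (2 * p)) • X ^ 2 +
      (β * AlphaBetaNorm.specRadius (star B * B) ^ p) • Y with hZ
    refine Real.sSup_le ?_ (by positivity)
    rintro s ⟨x, hx, rfl⟩
    have hp0 : 0 < p := by linarith
    set a := ‖(inner ℂ ((A * B) x) x : ℂ)‖
    have ha : 0 ≤ a := norm_nonneg _
    have hrB := AlphaBetaNorm.specRadius_nonneg B
    have h1 : (a ^ 2) ^ p ≤ AlphaBetaNorm.specRadius B ^ (2 * p) * (X ^ 2).reApplyInnerSelf x := by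
      have h2 := AlphaBetaNorm.norm_inner_mul_rpow_le A B hAB hAB' habs hf hg hf0 hg0 hfg hn hnm hp
        hpn hpm hx
      rw [← hX] at h2
      have hXsa : IsSelfAdjoint X := hX ▸ AlphaBetaNorm.isSelfAdjoint_youngSum ..
      have h3 := pow_le_pow_left₀ (Real.rpow_nonneg ha p) h2 2
      have e1 : (a ^ 2) ^ p = (a ^ p) ^ 2 := (Real.rpow_pow_comm ha p 2).symm
      have e2 : AlphaBetaNorm.specRadius B ^ (2 * p) = (AlphaBetaNorm.specRadius B ^ p) ^ 2 := by
        rw [mul_comm, Real.rpow_mul hrB]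
        norm_cast
      rw [e1, e2]
      refine h3.trans ?_
      rw [mul_pow]
      gcongr
      exact AlphaBetaNorm.reApplyInnerSelf_sq_le hXsa hx
    have h2 : (‖(A * B) x‖ ^ 2) ^ p ≤
        AlphaBetaNorm.specRadius (star B * B) ^ p * Y.reApplyInnerSelf x := by
      rw [AlphaBetaNorm.norm_mul_apply_sq hAB hAB', hY]
      -- The pair `A⋆A`, `B⋆B` satisfies the hypotheses on `A`, `B`, and `|A⋆A| = A⋆A`.
      have c1 : Commute A B := hAB
      have c2 : Commute A (star B) := hAB'
      have c3 : Commute (star A) (star B) := c1.star_star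
      have c4 : Commute (star A) B := by simpa using c2.star_star
      have c : Commute (star A * A) (star B * B) :=
        (c3.mul_left c2).mul_right (c4.mul_left c1)
      have hsA : star (star A * A) = star A * A := by rw [star_mul, star_star]
      have hsB : star (star B * B) = star B * B := by rw [star_mul, star_star]
      have h3 := AlphaBetaNorm.norm_inner_mul_rpow_le (star A * A) (star B * B) c.eq
        (by rw [hsB]; exact c.eq)
        (by rw [hsB, CFC.abs_of_nonneg _ (star_mul_self_nonneg A)]; exact c.eq)
        hf hg hf0 hg0 hfg hn hnm hp hpn hpm hx
      rwa [hsA] at h3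
    -- Jensen's inequality, since `α + β = 1`.
    have hconv : (α * a ^ 2 + β * ‖(A * B) x‖ ^ 2) ^ p ≤
        α * (a ^ 2) ^ p + β * (‖(A * B) x‖ ^ 2) ^ p :=
      (convexOn_rpow hp).2 (sq_nonneg a) (sq_nonneg ‖(A * B) x‖) hα hβ hαβ
    have h3 : (α * a ^ 2 + β * ‖(A * B) x‖ ^ 2) ^ p ≤ ‖Z‖ := by
      refine le_trans ?_ (AlphaBetaNorm.reApplyInnerSelf_le_norm Z hx)
      rw [hZ, AlphaBetaNorm.reApplyInnerSelf_add, AlphaBetaNorm.reApplyInnerSelf_real_smul,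
        AlphaBetaNorm.reApplyInnerSelf_real_smul, mul_assoc, mul_assoc]
      exact hconv.trans (by gcongr)
    have h0 : 0 ≤ α * a ^ 2 + β * ‖(A * B) x‖ ^ 2 := by positivity
    rw [Real.sqrt_eq_rpow]
    calc (α * a ^ 2 + β * ‖(A * B) x‖ ^ 2) ^ (1 / 2 : ℝ)
        = ((α * a ^ 2 + β * ‖(A * B) x‖ ^ 2) ^ p) ^ (1 / (2 * p)) := by
          rw [← Real.rpow_mul h0]
          congr 1
          field_simp
      _ ≤ ‖Z‖ ^ (1 / (2 * p)) := by gcongr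
  refine ⟨key, le_csInf ⟨_, 1, 0, by norm_num, by norm_num, by norm_num, rfl⟩ ?_⟩
  rintro c ⟨α, β, hα, hβ, hαβ, rfl⟩
  exact (AlphaBetaNorm.numRadius_le_abNorm hα hβ hαβ _).trans (key α β hα hβ hαβ)
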